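/- \textbf{Notation.} For $1\le k\le d$ and symmetric $A,B\in\mathbb R^{d\times d}$ write $A\preceq_k B$ if $\langle A,\Pi\rangle\le\langle B,\Pi\rangle$ for every orthogonal projection $\Pi$ onto a $(d-k+1)$-dimensional subspace of $\mathbb R^d$. A function $f:\mathbb S_d^+\to\mathbb R_{\ge 0}$ on the positive semidefinite $d\times d$ matrices is \emph{vector $k$-monotone} if for all $A,B\succeq 0$ and $v\in\mathbb R^d$, $vv^\top\preceq_k B$ implies $f(A+vv^\top)\ge f(A+B)$. For $t>0$ let $\beta(f,t)=\sup_{A\succeq 0} f(A)/f(tA)\in[0,\infty]$ (with $a/0=\infty$ for $a>0$ and $0/0=0$). For a finite $V\subset\mathbb R^d$ and a budget $B>0$, the \emph{fractional budgeted minimization problem} has the value $$\mathrm{OPT}_f(V,B)=\inf\Big\{f\Big(\sum_{v\in V}s_vvv^\top\Big): s_v\ge 0,\ \sum_{v\in V}s_v\le B\Big\}.$$ A map $c$ sending each finite $V\subset\mathbb R^d$ to a subset $c(V)\subseteq V$ is a \emph{$\rho$-composable core-set of size $t$} for this problem if $|c(V)|\le t$ for all $V$ and $\mathrm{OPT}_f(\bigcup_i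 c(V_i),B)\le\rho\cdot\mathrm{OPT}_f(\bigcup_i V_i,B)$ for all $B>0$ and all finite $V_1,\dots,V_p\subset\mathbb R^d$ (nothing is claimed about the approximation if $\rho=\infty$). \textbf{Algorithms} (all choices and ties are resolved arbitrarily). \emph{Spectral $d$-spanner}, run on a finite family $(\hat v)_{v\in V}$ with parameter $\alpha$: start with $W=\emptyset$; while there are $v\in V$ and $x\in\mathbb R^d$ with $\langle x,\hat v\rangle>\sqrt\alpha\,|\langle x,\hat u\rangle|$ for all $u\in W$, pick such $v,x$ and add to $W$ one $u\in V$ maximizing $\langle \hat u,x\rangle^2$; output $W\subseteq V$. Run on a set $V$ itself it uses $\hat v=v$. \emph{Spectral $k$-spanner}, run on $V$ with parameters $m,\alpha$: (1) start with $U=\emptyset$ and, until $|U|=m$ or $U=V$, add to $U$ an element of $V\setminus U$ whose projection onto $\langle U\rangle^\perp$ has the largest norm among all elements of $V$; (2) run the spectral $d$-spanner algorithm with parameter $\alpha$ on the family of the projections $\hat v$ of $v\in V$ onto $\langle U\rangle$, obtaining $W\subseteq V$; (3) output $U\cup W$. \textbf{Proposition.} There are universal constants $a,b,C>0$ such that the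 following holds. (i) For all $1\le k\le d$, the spectral $k$-spanner algorithm with $m=\lceil a\,k\log(k+1)\rceil$ and $\alpha=b\,k\log^3(k+1)$ always halts, every finite $V\subset\mathbb R^d$ has an output, and every map $c$ that assigns to each finite $V\subset\mathbb R^d$ a possible output of the algorithm is, for all vector $k$-monotone $f:\mathbb S_d^+\to\mathbb R_{\ge0}$ simultaneously, a $\beta\big(f,\,C\,k\log^3(k+1)\big)$-composable core-set of size $C\,k\log^2(k+1)$ for the fractional budgeted minimization problem. (ii) If $k=d\ge1$, then with $\alpha=b\,d\log^2(d+1)$, both for the spectral $k$-spanner algorithm with $k=d$ and $m=\lceil a\,d\log(d+1)\rceil$ and for the spectral $d$-spanner algorithm run on $V$ itself, the same holds with the improved bounds: $\beta\big(f,\,C\,d\log^2(d+1)\big)$-composable core-set of size $C\,d\log(d+1)$. -/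

import Mathlib

open scoped ENNReal NNReal

namespace SpectralSpanner

/-- Vectors of `ℝ^d` with the Euclidean inner product and norm. -/
abbrev Vec (d : ℕ) : Type := EuclideanSpace ℝ (Fin d)

/-- Real `d × d` matrices. -/
abbrev Mat (d : ℕ) : Type := Matrix (Fin d) (Fin d) ℝ

/-- The rank one matrix `v vᵀ`. -/
def outer {d : ℕ} (v : Vec d) : Mat d := Matrix.vecMulVec v.ofLp v.ofLp

/-- `P` is the matrix of the orthogonal projection onto some `r`-dimensional subspace. -/
def IsProjectionOfRank {d : ℕ} (r : ℕ) (P : Mat d) : Prop :=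
  P.transpose = P ∧ P * P = P ∧ P.rank = r

/-- The relation `A ≼ₖ B`: `⟨A, P⟩ ≤ ⟨B, P⟩` (Frobenius inner product) for every orthogonal
projection `P` onto a subspace of dimension `d - k + 1`. Used only for `1 ≤ k ≤ d`. -/
def KLe {d : ℕ} (k : ℕ) (A B : Mat d) : Prop :=
  ∀ P : Mat d, IsProjectionOfRank (d - k + 1) P →
    (A * P.transpose).trace ≤ (B * P.transpose).trace

/-- Vector `k`-monotone functions `f` from PSD matrices to nonnegative reals.
Functions on PSD matrices are represented by functions on all matrices whose values at matrices
that are not PSD are never looked at. -/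
def IsVectorMonotone {d : ℕ} (k : ℕ) (f : Mat d → ℝ≥0) : Prop :=
  ∀ (A B : Mat d) (v : Vec d), A.PosSemidef → B.PosSemidef → KLe k (outer v) B →
    f (A + B) ≤ f (A + outer v)

/-- `β(f, t) = sup_A f(A) / f(tA)` over PSD `A`, with values in `[0, ∞]`;
here `a / 0 = ∞` for `a > 0`, and `0 / 0 = 0`. -/
noncomputable def beta {d : ℕ} (f : Mat d → ℝ≥0) (t : ℝ) : ℝ≥0∞ :=
  ⨆ (A : Mat d) (_ : A.PosSemidef), (f A : ℝ≥0∞) / (f (t • A) : ℝ≥0∞)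

/-- Feasible solutions of the fractional budgeted minimization problem. -/
def IsFeasible {d : ℕ} (V : Finset (Vec d)) (B : ℝ) (s : Vec d → ℝ) : Prop :=
  (∀ v ∈ V, 0 ≤ s v) ∧ ∑ v ∈ V, s v ≤ B

/-- The optimal value (infimum) of the fractional budgeted minimization problem
with vectors `V`, objective `f` and budget `B`. -/
noncomputable def fracOpt {d : ℕ} (f : Mat d → ℝ≥0) (V : Finset (Vec d)) (B : ℝ) : ℝ≥0∞ :=
  ⨅ (s : Vec d → ℝ) (_ : IsFeasible V B s), (f (∑ v ∈ V, s v • outer v) : ℝ≥0∞)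

open scoped Classical in
/-- The map `c` is a `ρ`-composable core-set of size at most `t` for the fractional budgeted
minimization problem with objective `f` (and every budget): it selects at most `t` of the input
vectors, and the optimum over a union of selections is at most `ρ` times the optimum over the
union of the inputs (no approximation is claimed when `ρ = ∞`). -/
def IsComposableCoreset {d : ℕ} (f : Mat d → ℝ≥0) (ρ : ℝ≥0∞) (t : ℝ)
    (c : Finset (Vec d) → Finset (Vec d)) : Prop :=
  (∀ V, c V ⊆ V) ∧ (∀ V, ((c V).card : ℝ) ≤ t) ∧
    (ρ ≠ ⊤ → ∀ (B : ℝ), 0 < B → ∀ (p : ℕ) (V : Fin p → Finset (Vec d)),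
      fracOpt f (Finset.univ.biUnion fun i => c (V i)) B
        ≤ ρ * fracOpt f (Finset.univ.biUnion V) B)

/-! ### The greedy algorithm for spectral `d`-spanners

The algorithm is run on the indexed family of vectors `φ v`, `v ∈ V`; the plain algorithm is the
case `φ = id`. -/

/-- The loop test: `x` lies in the polytope `P_v`, i.e. `⟨x, φ v⟩ > √α |⟨x, φ u⟩|`
for all `u` selected so far. -/
def IsBad {d : ℕ} (φ : Vec d → Vec d) (α : ℝ) (U : Finset (Vec d)) (v x : Vec d) : Prop :=
  ∀ u ∈ U, Real.sqrt α * |inner ℝ x (φ u)| < inner ℝ x (φ v)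

open scoped Classical in
/-- One execution of the loop body: pick any `v ∈ V` and any `x ∈ P_v`, and add a maximizer of
`⟨φ u, x⟩²` over `u ∈ V`. All choices and ties are resolved arbitrarily. -/
def DSpannerStep {d : ℕ} (V : Finset (Vec d)) (φ : Vec d → Vec d) (α : ℝ)
    (U U' : Finset (Vec d)) : Prop :=
  ∃ v ∈ V, ∃ x : Vec d, IsBad φ α U v x ∧
    ∃ u ∈ V, (∀ w ∈ V, (inner ℝ (φ w) x : ℝ) ^ 2 ≤ (inner ℝ (φ u) x : ℝ) ^ 2) ∧ U' = insert u U

/-- `U` is a possible output of the algorithm: it is reached from `∅`, and the loop test fails. -/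
def DSpannerOutput {d : ℕ} (V : Finset (Vec d)) (φ : Vec d → Vec d) (α : ℝ)
    (U : Finset (Vec d)) : Prop :=
  Relation.ReflTransGen (DSpannerStep V φ α) ∅ U ∧ ∀ v ∈ V, ∀ x : Vec d, ¬ IsBad φ α U v x

/-- The loop cannot run forever, whatever choices are made. -/
def DSpannerHalts {d : ℕ} (V : Finset (Vec d)) (φ : Vec d → Vec d) (α : ℝ) : Prop :=
  ¬ ∃ g : ℕ → Finset (Vec d), g 0 = ∅ ∧ ∀ n, DSpannerStep V φ α (g n) (g (n + 1))

/-! ### Greedy volume maximization -/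

open scoped Classical in
/-- One step: add a vector `u` of `V`, not selected before, whose projection onto the orthogonal
complement of the span of the selected vectors is the longest one among all vectors of `V`. -/
def VolumeStep {d : ℕ} (V U U' : Finset (Vec d)) : Prop :=
  ∃ u ∈ V, u ∉ U ∧
    (∀ w ∈ V, ‖(Submodule.span ℝ (U : Set (Vec d)))ᗮ.starProjection w‖
      ≤ ‖(Submodule.span ℝ (U : Set (Vec d)))ᗮ.starProjection u‖) ∧
    U' = insert u U

/-- `U` is a possible output: `m` vectors were selected, or all of `V` if `V` has fewer. -/
def VolumeOutput {d : ℕ} (V : Finset (Vec d)) (m : ℕ) (U : Finset (Vec d)) : Prop :=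
  Relation.ReflTransGen (VolumeStep V) ∅ U ∧ U.card = min m V.card

/-! ### The algorithm for spectral `k`-spanners -/

open scoped Classical in
/-- `S` is a possible output: greedy volume maximization selects `U`, the `d`-spanner algorithm
is run on the projections of the vectors of `V` onto the span of `U` and selects the vectors `W`
of `V`, and `S = U ∪ W`. -/
def KSpannerOutput {d : ℕ} (V : Finset (Vec d)) (m : ℕ) (α : ℝ) (S : Finset (Vec d)) : Prop :=
  ∃ U W : Finset (Vec d), VolumeOutput V m U ∧
    DSpannerOutput V (Submodule.span ℝ (U : Set (Vec d))).starProjection α W ∧ S = U ∪ W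

/-- The algorithm halts, whatever choices are made. -/
def KSpannerHalts {d : ℕ} (V : Finset (Vec d)) (m : ℕ) (α : ℝ) : Prop :=
  ∀ U : Finset (Vec d), VolumeOutput V m U →
    DSpannerHalts V (Submodule.span ℝ (U : Set (Vec d))).starProjection α

/-- An algorithm with the input-output relation `Out` gives, for every vector `k`-monotone `f`,
a `β(f, τ)`-composable core-set of size at most `t`: every input has an output, and every map
that assigns to each input a possible output of the algorithm is such a core-set, for all `f`
simultaneously. -/
def GivesCoreset {d : ℕ} (Out : Finset (Vec d) → Finset (Vec d) → Prop) (k : ℕ) (τ t : ℝ) :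
    Prop :=
  (∀ V, ∃ S, Out V S) ∧
    ∀ c : Finset (Vec d) → Finset (Vec d), (∀ V, Out V (c V)) →
      ∀ f : Mat d → ℝ≥0, IsVectorMonotone k f → IsComposableCoreset f (beta f τ) t c

end SpectralSpanner

namespace SpectralSpanner

/-! Everything rests on one rigidity fact, `quarter_le_frobenius_sq_sub`: if an `m × m` matrix has
determinant `1` and entries in `[-1, 1]`, and `m` exceeds `k` by a logarithmic factor, then its
squared Frobenius distance to matrices of rank at most `k` is at least `m / 4`. It is applied twice.

Spectral `d`-spanner: witnesses of successive steps, normalized, pair with the selected vectors in a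
matrix with unit diagonal, entries in `[-1, 1]` and entries at most `1/√α` below the diagonal.
Clearing the lower triangle gives determinant `1` and moves the matrix by at most `m²/α` in squared
norm. The rank is at most the ambient dimension, so `m` steps are impossible once `α > 4m`
(`card_le_of_reachable`). When the loop stops, Hahn-Banach writes each vector as a combination of
selected ones with `ℓ¹` norm at most `√α`, and Cauchy-Schwarz turns this into spectral domination of
total weight `α`.

Greedy volume maximization: the Gram-Schmidt coefficients of the selected vectors form a
unitriangular matrix with entries in `[-1, 1]`. If `1 - P` has rank at most `k`, replacing `P` by
`0` changes it by a matrix of rank at most `k`; hence the `P u` cannot all be short compared with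
the distances of the input vectors from the span (`card_mul_norm_sq_le_sum`).

For the `k`-spanner, `v` is split into its parts in the span of `U` and orthogonal to it: the
`d`-spanner dominates the first, greedy volume the second (`exists_weights_of_kSpannerOutput`).
Domination survives unions, and vector monotonicity lets each `v vᵀ` be replaced by its dominating
combination; rescaling to the budget costs `β` (`fracOpt_le_beta_mul`). -/

/-! ### Distance of determinant-one matrices from low rank -/

lemma det_le_trace_div_pow {m : ℕ} (hm : 0 < m) {A : Mat m} (hA : A.PosSemidef) :
    A.det ≤ (A.trace / m) ^ m := by
  have hm' : (0 : ℝ) < m := by exact_mod_cast hm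
  have hprod : A.det = ∏ i, hA.isHermitian.eigenvalues i := by
    simpa using hA.isHermitian.det_eq_prod_eigenvalues
  have hsum : A.trace = ∑ i, hA.isHermitian.eigenvalues i := by
    simpa using hA.isHermitian.trace_eq_sum_eigenvalues
  have h := Real.geom_mean_le_arith_mean (Finset.univ : Finset (Fin m)) (fun _ => 1)
    hA.isHermitian.eigenvalues (fun _ _ => zero_le_one) (by simpa using hm)
    (fun i _ => hA.eigenvalues_nonneg i)
  simp only [Real.rpow_one, one_mul, Finset.sum_const, Finset.card_univ, Fintype.card_fin,
    nsmul_eq_mul, mul_one] at h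
  rw [← hprod, ← hsum] at h
  have h2 := pow_le_pow_left₀ (Real.rpow_nonneg hA.det_nonneg _) h m
  rwa [Real.rpow_inv_natCast_pow hA.det_nonneg hm.ne'] at h2

lemma trace_transpose_mul_self {m n : ℕ} (Z : Matrix (Fin m) (Fin n) ℝ) :
    (Z.transpose * Z).trace = ∑ i, ∑ j, Z i j ^ 2 := by
  rw [Finset.sum_comm]
  simp [Matrix.trace, Matrix.mul_apply, sq]

/-- Orthonormal columns spanning a given subspace. -/
lemma exists_orthonormal_columns {m : ℕ} (F : Submodule ℝ (Vec m)) :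
    ∃ r, r ≤ Module.finrank ℝ F ∧ ∃ B : Matrix (Fin m) (Fin r) ℝ, B.transpose * B = 1 ∧
      ∀ y ∈ F, (B * B.transpose).mulVec y.ofLp = y.ofLp := by
  let b := stdOrthonormalBasis ℝ F
  refine ⟨_, le_rfl, Matrix.of fun i j => (b j : Vec m) i, ?_, fun y hy => ?_⟩
  · ext i j
    have h := orthonormal_iff_ite.1 b.orthonormal i j
    rw [Submodule.coe_inner, PiLp.inner_apply] at h
    simpa [Matrix.mul_apply, Matrix.one_apply, mul_comm] using h
  · have h := congrArg (fun z : F => (z : Vec m).ofLp) (b.sum_repr ⟨y, hy⟩)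
    simp only [Submodule.coe_sum, Submodule.coe_smul, b.repr_apply_apply, Submodule.coe_inner]
      at h
    rw [← Matrix.mulVec_mulVec]
    conv_rhs => rw [← h]
    ext i
    simp [Matrix.mulVec, dotProduct, PiLp.inner_apply, mul_comm]

/-- A matrix of determinant one with entries in `[-1, 1]` is far from every matrix of low rank. -/
lemma quarter_le_frobenius_sq_sub {E : Type*} [NormedAddCommGroup E] [InnerProductSpace ℝ E]
    {m k : ℕ} (hm : 0 < m)
    (hk : k * Real.log (4 * m) ≤ m * Real.log 2) {T : Mat m} (hdet : T.det = 1)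
    (hT : ∀ i j, |T i j| ≤ 1) (F : Submodule ℝ E) [FiniteDimensional ℝ F]
    (hF : Module.finrank ℝ F ≤ k) (w y : Fin m → E) (hy : ∀ j, y j ∈ F) :
    (m : ℝ) / 4 ≤ ∑ i, ∑ j, (T i j - inner ℝ (w i) (y j)) ^ 2 := by
  have hm1 : (1 : ℝ) ≤ m := by exact_mod_cast hm
  have hm' : (0 : ℝ) < m := by exact_mod_cast hm
  let N : Mat m := Matrix.of fun i j => inner ℝ (w i) (y j)
  let Z : Mat m := T - N
  -- The columns of `N` lie in `g(F)`, of dimension at most `k`. With `P` the orthogonal projection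
  -- onto this space, `1 - P` kills `N` and so does not distinguish `T` from `Z`.
  let g : E →ₗ[ℝ] Vec m :=
    (WithLp.linearEquiv 2 ℝ (Fin m → ℝ)).symm.toLinearMap ∘ₗ
      LinearMap.pi fun i => (innerSL ℝ (w i)).toLinearMap
  obtain ⟨r, hr', B, hBB, hB⟩ := exists_orthonormal_columns (F.map g)
  have hr : r ≤ k := hr'.trans ((Submodule.finrank_map_le g F).trans hF)
  set P : Mat m := B * B.transpose with hP
  have hPt : P.transpose = P := by simp [hP, Matrix.transpose_mul]
  have hPP : P * P = P := by
    rw [hP, Matrix.mul_assoc, ← Matrix.mul_assoc B.transpose, hBB, Matrix.one_mul]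
  have hPN : P * N = N := by
    ext i j
    have h := congrFun (hB _ (Submodule.mem_map_of_mem (f := g) (hy j))) i
    rw [Matrix.mul_apply]
    simpa [Matrix.mulVec, dotProduct, N, g] using h
  have hTN : (1 - P) * T = (1 - P) * Z := by
    simp only [Z, mul_sub, sub_mul, hPN, one_mul]; abel
  have hQQ : (1 - P).transpose * (1 - P) = 1 - P := by
    rw [Matrix.transpose_sub, hPt, Matrix.transpose_one, sub_mul, mul_sub, mul_sub, hPP]; simp
  set x : ℝ := 1 / (4 * m) with hx
  have hx0 : 0 < x := by positivity
  have hx1 : x ≤ 1 := by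
    rw [hx, div_le_one (by positivity)]; linarith
  clear_value x
  -- `A = Tᵀ(1 - (1 - x)P)T` damps only the range of `P`. Its determinant is `x ^ r`, while its
  -- trace is at most `x m² + ‖Z‖²`; AM-GM compares the two. The choice `x = 1/(4m)` makes the first
  -- term `m / 4`.
  let A : Mat m := x • (T.transpose * T) +
    (1 - x) • (((1 - P) * T).transpose * ((1 - P) * T))
  have hApsd : A.PosSemidef := by
    refine Matrix.PosSemidef.add (Matrix.PosSemidef.smul ?_ hx0.le)
      (Matrix.PosSemidef.smul ?_ (sub_nonneg.2 hx1))
    · simpa using Matrix.posSemidef_conjTranspose_mul_self T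
    · rw [← Matrix.conjTranspose_eq_transpose_of_trivial]
      exact Matrix.posSemidef_conjTranspose_mul_self _
  have hAeq : A = T.transpose * (1 - ((1 - x) • B) * B.transpose) * T := by
    have h1 : ((1 - P) * T).transpose * ((1 - P) * T) = T.transpose * (1 - P) * T := by
      rw [Matrix.transpose_mul, Matrix.mul_assoc, ← Matrix.mul_assoc _ (1 - P) T, hQQ,
        Matrix.mul_assoc]
    have h2 : A = x • (T.transpose * T) + (1 - x) • (T.transpose * (1 - P) * T) := by rw [← h1]
    rw [h2, Matrix.smul_mul, ← hP]
    simp only [mul_sub, sub_mul, mul_one, Matrix.mul_smul, Matrix.smul_mul]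
    module
  have hAdet : A.det = x ^ r := by
    rw [hAeq, Matrix.det_mul, Matrix.det_mul, Matrix.det_transpose, hdet,
      Matrix.det_one_sub_mul_comm, Matrix.mul_smul, hBB]
    have : (1 : Matrix (Fin r) (Fin r) ℝ) - (1 - x) • (1 : Matrix (Fin r) (Fin r) ℝ)
        = x • (1 : Matrix (Fin r) (Fin r) ℝ) := by module
    rw [this, Matrix.det_smul]
    simp
  have hS0 : 0 ≤ ∑ i, ∑ j, Z i j ^ 2 := by positivity
  have htr : A.trace ≤ x * m ^ 2 + ∑ i, ∑ j, Z i j ^ 2 := by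
    have h1 : (T.transpose * T).trace ≤ (m : ℝ) ^ 2 := by
      rw [trace_transpose_mul_self]
      calc ∑ i, ∑ j, T i j ^ 2 ≤ ∑ _i : Fin m, ∑ _j : Fin m, (1 : ℝ) := by
            gcongr with i _ j _
            exact (sq_le_one_iff_abs_le_one _).2 (hT i j)
        _ = (m : ℝ) ^ 2 := by simp [sq]
    have h2 : (((1 - P) * T).transpose * ((1 - P) * T)).trace ≤ ∑ i, ∑ j, Z i j ^ 2 := by
      rw [hTN, Matrix.transpose_mul, Matrix.mul_assoc, ← Matrix.mul_assoc _ (1 - P) Z, hQQ,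
        ← trace_transpose_mul_self, sub_mul, mul_sub, Matrix.trace_sub, one_mul]
      have h3 : Z.transpose * (P * Z) = (B.transpose * Z).transpose * (B.transpose * Z) := by
        simp [hP, Matrix.transpose_mul, Matrix.mul_assoc]
      rw [h3, trace_transpose_mul_self (B.transpose * Z)]
      have : 0 ≤ ∑ i, ∑ j, (B.transpose * Z) i j ^ 2 := by positivity
      linarith
    have h4 : A.trace = x * (T.transpose * T).trace
        + (1 - x) * (((1 - P) * T).transpose * ((1 - P) * T)).trace := by
      simp only [A, Matrix.trace_add, Matrix.trace_smul, smul_eq_mul]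
    rw [h4]
    have h5 : (1 - x) * (((1 - P) * T).transpose * ((1 - P) * T)).trace
        ≤ 1 * ∑ i, ∑ j, Z i j ^ 2 := by
      refine mul_le_mul (by linarith) h2 ?_ zero_le_one
      rw [trace_transpose_mul_self]; positivity
    have h6 := mul_le_mul_of_nonneg_left h1 hx0.le
    linarith
  have hamgm := det_le_trace_div_pow hm hApsd
  -- The hypothesis `hk` says exactly `(4m) ^ k ≤ 2 ^ m`.
  have hlow : ((1 : ℝ) / 2) ^ m ≤ A.det := by
    rw [hAdet]
    have h1 : x ^ k ≤ x ^ r := pow_le_pow_of_le_one hx0.le hx1 hr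
    refine le_trans ?_ h1
    rw [← Real.log_le_log_iff (by positivity) (by positivity), Real.log_pow, Real.log_pow, hx]
    simp only [one_div, Real.log_inv]
    linarith
  have hA0 : 0 ≤ A.trace := hApsd.trace_nonneg
  have hfin : (1 : ℝ) / 2 ≤ A.trace / m :=
    le_of_pow_le_pow_left₀ hm.ne' (by positivity) (hlow.trans hamgm)
  rw [le_div_iff₀ hm'] at hfin
  have hxm : x * m ^ 2 = m / 4 := by rw [hx]; field_simp
  have hZ : ∑ i, ∑ j, Z i j ^ 2 = ∑ i, ∑ j, (T i j - inner ℝ (w i) (y j)) ^ 2 := rfl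
  linarith

/-! ### Spectral domination when the loop stops -/

/-- If the loop test fails at `v`, then `φ v` is a combination of the selected vectors with
coefficients of total size at most `√α`. -/
lemma exists_coeff_of_forall_not_isBad {d : ℕ} {φ : Vec d → Vec d} {α : ℝ}
    {W : Finset (Vec d)} {v : Vec d} (h : ∀ x, ¬ IsBad φ α W v x) :
    ∃ c : Vec d → ℝ, ∑ u ∈ W, |c u| ≤ Real.sqrt α ∧ φ v = ∑ u ∈ W, c u • φ u := by
  classical
  let s : Set (Vec d) := {y | ∃ c : Vec d → ℝ, ∑ u ∈ W, |c u| ≤ Real.sqrt α ∧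
    y = ∑ u ∈ W, c u • φ u}
  by_contra hv
  have hvs : φ v ∉ s := hv
  let L : PiLp 1 (fun _ : W => ℝ) →ₗ[ℝ] Vec d :=
    { toFun := fun c => ∑ u, c u • φ u
      map_add' := fun c c' => by simp [add_smul, Finset.sum_add_distrib]
      map_smul' := fun t c => by simp [Finset.smul_sum, smul_smul] }
  -- As a linear image of an `ℓ¹` ball, `s` is convex and compact, so a point outside it can be
  -- strictly separated; the separating functional is represented by a vector `x` that passes the
  -- loop test.
  have hs : s = L '' Metric.closedBall 0 (Real.sqrt α) := by
    ext y
    simp only [s, Set.mem_ofPred_eq, Set.mem_image, mem_closedBall_zero_iff, PiLp.norm_eq_of_L1]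
    constructor
    · rintro ⟨c, hc, rfl⟩
      refine ⟨WithLp.toLp 1 fun u => c u, ?_, ?_⟩
      · simpa using (Finset.sum_attach W fun u => |c u|).trans_le hc
      · simpa [L] using Finset.sum_attach W fun u => c u • φ u
    · rintro ⟨c, hc, rfl⟩
      refine ⟨fun u => if hu : u ∈ W then c ⟨u, hu⟩ else 0, ?_, ?_⟩
      · rw [← Finset.sum_coe_sort]
        simpa using hc
      · rw [← Finset.sum_coe_sort]
        simp [L]
  have hconv : Convex ℝ s := hs ▸ (convex_closedBall _ _).linear_image L
  have hclosed : IsClosed s :=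
    hs ▸ ((isCompact_closedBall _ _).image L.continuous_of_finiteDimensional).isClosed
  obtain ⟨f, t, hft, htv⟩ := geometric_hahn_banach_closed_point hconv hclosed hvs
  refine h ((InnerProductSpace.toDual ℝ _).symm f) fun u hu => ?_
  simp only [InnerProductSpace.toDual_symm_apply]
  have key : ∀ ε : ℝ, |ε| = Real.sqrt α → ε * f (φ u) < f (φ v) := by
    intro ε hε
    have := hft (ε • φ u) ⟨fun w => if w = u then ε else 0, by
      rw [Finset.sum_eq_single_of_mem u hu (by intro b _ hb; simp [hb])]
      simp [hε], by
      rw [Finset.sum_eq_single_of_mem u hu (by intro b _ hb; simp [hb])]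
      simp⟩
    simpa using this.trans htv
  have h0 := Real.sqrt_nonneg α
  rcases abs_cases (f (φ u)) with ⟨h1, _⟩ | ⟨h1, _⟩
  · rw [h1]; exact key _ (abs_of_nonneg h0)
  · rw [h1]; have := key (-Real.sqrt α) (by rw [abs_neg, abs_of_nonneg h0]); linarith

/-- Cauchy-Schwarz with weights `|c u|`; the `ℓ¹` bound `√α` enters twice, which gives total weight
`α`. The weights do not depend on `P`. -/
lemma exists_weights_of_forall_not_isBad {d : ℕ} {φ : Vec d → Vec d} {α : ℝ} (hα : 0 ≤ α)
    {W : Finset (Vec d)} {v : Vec d} (h : ∀ x, ¬ IsBad φ α W v x) :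
    ∃ μ : Vec d → ℝ, (∀ u, 0 ≤ μ u) ∧ ∑ u ∈ W, μ u ≤ α ∧
      ∀ P : Vec d →ₗ[ℝ] Vec d, ‖P (φ v)‖ ^ 2 ≤ ∑ u ∈ W, μ u * ‖P (φ u)‖ ^ 2 := by
  obtain ⟨c, hc, hv⟩ := exists_coeff_of_forall_not_isBad h
  have h0 := Real.sqrt_nonneg α
  refine ⟨fun u => Real.sqrt α * |c u|, fun u => by positivity, ?_, fun P => ?_⟩
  · rw [← Finset.mul_sum]
    calc _ ≤ Real.sqrt α * Real.sqrt α := by gcongr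
      _ = α := Real.mul_self_sqrt hα
  · have h1 : ‖P (φ v)‖ ≤ ∑ u ∈ W, |c u| * ‖P (φ u)‖ := by
      rw [hv, map_sum]
      refine (norm_sum_le _ _).trans_eq (Finset.sum_congr rfl fun u _ => ?_)
      rw [map_smul, norm_smul, Real.norm_eq_abs]
    calc ‖P (φ v)‖ ^ 2 ≤ (∑ u ∈ W, |c u| * ‖P (φ u)‖) ^ 2 := by gcongr
      _ ≤ (∑ u ∈ W, |c u|) * ∑ u ∈ W, |c u| * ‖P (φ u)‖ ^ 2 := by
          refine Finset.sum_sq_le_sum_mul_sum_of_sq_le_mul _ (fun u _ => abs_nonneg _)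
            (fun u _ => by positivity) fun u _ => by ring_nf; rfl
      _ ≤ Real.sqrt α * ∑ u ∈ W, |c u| * ‖P (φ u)‖ ^ 2 := by gcongr
      _ = _ := by rw [Finset.mul_sum]; simp only [mul_assoc]

/-! ### Halting and size of the spectral `d`-spanner -/

section Steps
variable {d : ℕ} {V : Finset (Vec d)} {φ : Vec d → Vec d} {α : ℝ} {U U' : Finset (Vec d)}

lemma DSpannerStep.subset_of_subset (h : DSpannerStep V φ α U U') (hU : U ⊆ V) : U' ⊆ V := by
  obtain ⟨v, hv, x, hx, u, hu, hmax, rfl⟩ := h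
  exact Finset.insert_subset hu hU

lemma DSpannerStep.card_lt_card (hα : 1 ≤ α) (h : DSpannerStep V φ α U U') :
    U.card < U'.card := by
  obtain ⟨v, hv, x, hx, u, hu, hmax, rfl⟩ := h
  have hnot : u ∉ U := by
    intro huU
    have h1 := hx u huU
    have h2 : |inner ℝ x (φ v)| ≤ |inner ℝ x (φ u)| := by
      have := sq_le_sq.1 (hmax v hv)
      rwa [real_inner_comm, real_inner_comm x] at this
    have h3 : 1 ≤ Real.sqrt α := Real.one_le_sqrt.2 hα
    nlinarith [abs_nonneg (inner ℝ x (φ u)), le_abs_self (inner ℝ x (φ v))]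
  rw [Finset.card_insert_of_notMem hnot]
  exact Nat.lt_succ_self _

lemma subset_of_reachable (h : Relation.ReflTransGen (DSpannerStep V φ α) ∅ U) : U ⊆ V := by
  induction h with
  | refl => simp
  | tail _ hs ih => exact hs.subset_of_subset ih

lemma dSpannerHalts (hα : 1 ≤ α) : DSpannerHalts V φ α := by
  rintro ⟨g, hg0, hg⟩
  have h1 : ∀ n, g n ⊆ V ∧ n ≤ (g n).card := by
    intro n
    induction n with
    | zero => simp [hg0]
    | succ n ih =>
      exact ⟨(hg n).subset_of_subset ih.1, ih.2.trans_lt ((hg n).card_lt_card hα)⟩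
  have h2 := h1 (V.card + 1)
  have h3 := Finset.card_le_card h2.1
  omega

lemma exists_dSpannerOutput (hα : 1 ≤ α) : ∃ W, DSpannerOutput V φ α W := by
  classical
  let R := V.powerset.filter fun U => Relation.ReflTransGen (DSpannerStep V φ α) ∅ U
  have hR : R.Nonempty := ⟨∅, by simp [R, Relation.ReflTransGen.refl]⟩
  obtain ⟨W, hW, hmax⟩ := R.exists_max_image Finset.card hR
  have hreach : Relation.ReflTransGen (DSpannerStep V φ α) ∅ W := (Finset.mem_filter.1 hW).2
  refine ⟨W, hreach, fun v hv x hx => ?_⟩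
  obtain ⟨u, hu, humax⟩ := V.exists_max_image (fun w => (inner ℝ (φ w) x : ℝ) ^ 2) ⟨v, hv⟩
  have hstep : DSpannerStep V φ α W (insert u W) := ⟨v, hv, x, hx, u, hu, humax, rfl⟩
  have hreach' := hreach.tail hstep
  have := hmax _ (Finset.mem_filter.2 ⟨Finset.mem_powerset.2 (subset_of_reachable hreach'),
    hreach'⟩)
  exact absurd (hstep.card_lt_card hα) (not_lt.2 this)

/-- The vectors selected after the first step, with normalized witnesses. -/
lemma exists_witnesses_of_reachable (h : Relation.ReflTransGen (DSpannerStep V φ α) ∅ U) :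
    U = ∅ ∨ ∃ (n : ℕ) (u x : ℕ → Vec d), U.card ≤ n + 1 ∧ U.Nonempty ∧ ∀ i < n,
      u i ∈ U ∧ inner ℝ (x i) (φ (u i)) = (1 : ℝ) ∧
      (∀ w ∈ V, |(inner ℝ (x i) (φ w) : ℝ)| ≤ 1) ∧
      ∀ j < i, Real.sqrt α * |(inner ℝ (x i) (φ (u j)) : ℝ)| ≤ 1 := by
  classical
  induction h with
  | refl => exact Or.inl rfl
  | @tail U U' _ hs ih =>
    right
    obtain ⟨v, hv, x', hx, u', hu, hmax, rfl⟩ := hs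
    rcases ih with rfl | ⟨n, u, x, hcard, hne, hux⟩
    -- The first test is vacuous, so its `x` may be `0` and cannot be normalized. This step gives no
    -- witness, whence the bound `n + 1`.
    · exact ⟨0, fun _ => 0, fun _ => 0, by simp, by simp, by simp⟩
    have hmax' : ∀ w ∈ V, |inner ℝ x' (φ w)| ≤ |inner ℝ x' (φ u')| := by
      intro w hw
      have := sq_le_sq.1 (hmax w hw)
      rwa [real_inner_comm, real_inner_comm x'] at this
    have hpos : 0 < |inner ℝ x' (φ u')| := by
      obtain ⟨w, hw⟩ := hne
      have := hx w hw
      have h0 : 0 ≤ Real.sqrt α * |inner ℝ x' (φ w)| := by positivity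
      exact (h0.trans_lt this).trans_le ((le_abs_self _).trans (hmax' v hv))
    refine ⟨n + 1, Function.update u n u',
      Function.update x n ((inner ℝ x' (φ u'))⁻¹ • x'), ?_, by simp, ?_⟩
    · exact (Finset.card_insert_le _ _).trans (by omega)
    intro i hi
    rcases Nat.lt_succ_iff_lt_or_eq.1 hi with hi | rfl
    · obtain ⟨h1, h2, h3, h4⟩ := hux i hi
      rw [Function.update_of_ne hi.ne, Function.update_of_ne hi.ne]
      refine ⟨Finset.mem_insert_of_mem h1, h2, h3, fun j hj => ?_⟩
      rw [Function.update_of_ne (hj.trans hi).ne]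
      exact h4 j hj
    · simp only [Function.update_self, inner_smul_left, abs_mul, abs_inv,
        RCLike.conj_to_real]
      refine ⟨Finset.mem_insert_self _ _, inv_mul_cancel₀ (abs_pos.1 hpos), fun w hw => ?_,
        fun j hj => ?_⟩
      · rw [inv_mul_le_one₀ hpos]; exact hmax' w hw
      · rw [Function.update_of_ne hj.ne, mul_left_comm, inv_mul_le_one₀ hpos]
        exact (hx _ (hux j hj).1).le.trans ((le_abs_self _).trans (hmax' v hv))

/-- With more than `m` selected vectors there are `m` normalized witnesses, and the resulting matrix
would be within `m²/α < m/4` of rank at most `D`. -/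
lemma card_le_of_reachable {D m : ℕ} (hm : 0 < m)
    (hD : D * Real.log (4 * m) ≤ m * Real.log 2) (hα : 4 * m < α)
    (F : Submodule ℝ (Vec d)) (hF : Module.finrank ℝ F ≤ D) (hφ : ∀ v, φ v ∈ F)
    (h : Relation.ReflTransGen (DSpannerStep V φ α) ∅ U) : U.card ≤ m := by
  by_contra! hcard
  have hUV := subset_of_reachable h
  rcases exists_witnesses_of_reachable h with rfl | ⟨n, u, x, hn, -, hux⟩
  · simp at hcard
  have hmn : m ≤ n := by omega
  have hm' : (0 : ℝ) < m := by exact_mod_cast hm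
  have hα0 : 0 < α := by linarith
  let T : Mat m := Matrix.of fun i j => if j < i then 0 else inner ℝ (x i) (φ (u j))
  have hdet : T.det = 1 := by
    rw [Matrix.det_of_isUpperTriangular]
    · refine Finset.prod_eq_one fun i _ => ?_
      simpa [T] using (hux i (by omega)).2.1
    · intro i j hij
      simp only [id] at hij
      simp [T, hij]
  have hT : ∀ i j, |T i j| ≤ 1 := by
    intro i j
    by_cases hij : j < i
    · simp [T, hij]
    · simpa [T, hij] using (hux i (by omega)).2.2.1 _ (hUV (hux j (by omega)).1)
  have hmain := quarter_le_frobenius_sq_sub hm hD hdet hT F hF (fun i => x i)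
    (fun j => φ (u j)) fun j => hφ _
  have hle : ∑ i : Fin m, ∑ j : Fin m, (T i j - inner ℝ (x i) (φ (u j))) ^ 2
      ≤ ∑ _i : Fin m, ∑ _j : Fin m, 1 / α := by
    gcongr with i _ j _
    by_cases hij : j < i
    · have h1 := (hux i (by omega)).2.2.2 j hij
      have h2 : (Real.sqrt α * |inner ℝ (x i) (φ (u j))|) ^ 2 ≤ 1 :=
        pow_le_one₀ (by positivity) h1
      rw [mul_pow, Real.sq_sqrt hα0.le, sq_abs] at h2
      simp only [T, Matrix.of_apply, hij, if_true, zero_sub, neg_sq]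
      rw [le_div_iff₀ hα0]; linarith
    · simp [T, hij, hα0.le]
  simp only [Finset.sum_const, Finset.card_univ, Fintype.card_fin, nsmul_eq_mul] at hle
  have h3 : (m : ℝ) / 4 ≤ m * (m * (1 / α)) := hmain.trans hle
  rw [mul_one_div, ← mul_div_assoc, div_le_div_iff₀ (by norm_num) hα0] at h3
  nlinarith

end Steps

/-! ### Greedy volume maximization -/

section Volume
variable {d : ℕ} {V U U' : Finset (Vec d)}

lemma VolumeStep.subset_of_subset (h : VolumeStep V U U') (hU : U ⊆ V) : U' ⊆ V := by
  obtain ⟨u, hu, -, -, rfl⟩ := h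
  exact Finset.insert_subset hu hU

lemma subset_of_volumeReachable (h : Relation.ReflTransGen (VolumeStep V) ∅ U) : U ⊆ V := by
  induction h with
  | refl => simp
  | tail _ hs ih => exact hs.subset_of_subset ih

lemma starProjection_orthogonal_span_eq_zero {u : Vec d} (hu : u ∈ U) :
    (Submodule.span ℝ (U : Set (Vec d)))ᗮ.starProjection u = 0 := by
  rw [Submodule.starProjection_apply_eq_zero_iff, Submodule.orthogonal_orthogonal]
  exact Submodule.subset_span hu

lemma exists_volumeOutput (V : Finset (Vec d)) (m : ℕ) : ∃ U, VolumeOutput V m U := by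
  classical
  suffices h : ∀ n ≤ V.card, ∃ U, Relation.ReflTransGen (VolumeStep V) ∅ U ∧ U.card = n from
    h _ (min_le_right _ _)
  intro n
  induction n with
  | zero => exact fun _ => ⟨∅, Relation.ReflTransGen.refl, rfl⟩
  | succ n ih =>
    intro hn
    obtain ⟨U, hU, hcard⟩ := ih (by omega)
    have hne : (V \ U).Nonempty := by
      rw [Finset.sdiff_nonempty]
      intro hsub
      have := Finset.card_le_card hsub
      omega
    obtain ⟨u, hu, hmax⟩ := (V \ U).exists_max_image
      (fun w => ‖(Submodule.span ℝ (U : Set (Vec d)))ᗮ.starProjection w‖) hne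
    rw [Finset.mem_sdiff] at hu
    refine ⟨insert u U, hU.tail ⟨u, hu.1, hu.2, fun w hw => ?_, rfl⟩, ?_⟩
    · by_cases hwU : w ∈ U
      · rw [starProjection_orthogonal_span_eq_zero hwU, norm_zero]
        exact norm_nonneg _
      · exact hmax w (Finset.mem_sdiff.2 ⟨hw, hwU⟩)
    · rw [Finset.card_insert_of_notMem hu.2, hcard]

/-- The Gram-Schmidt process along a run of greedy volume maximization. -/
lemma exists_gramSchmidt_of_volumeReachable (h : Relation.ReflTransGen (VolumeStep V) ∅ U) :
    ∃ u w : ℕ → Vec d,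
      (∀ g : Vec d → ℝ, ∑ v ∈ U, g v = ∑ i ∈ Finset.range U.card, g (u i)) ∧
      ∀ i < U.card, u i ∈ U ∧ w i ∈ Submodule.span ℝ (U : Set (Vec d)) ∧
        (∀ j < i, inner ℝ (w i) (w j) = (0 : ℝ) ∧ inner ℝ (w i) (u j) = (0 : ℝ)) ∧
        inner ℝ (w i) (u i) = ‖w i‖ ^ 2 ∧
        ∀ v ∈ V, |inner ℝ (w i) v| ≤ ‖w i‖ ^ 2 ∧
          ‖(Submodule.span ℝ (U : Set (Vec d)))ᗮ.starProjection v‖ ≤ ‖w i‖ := by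
  classical
  induction h with
  | refl => exact ⟨fun _ => 0, fun _ => 0, by simp, by simp⟩
  | @tail U U' _ hs ih =>
    obtain ⟨u, w, hsum, huw⟩ := ih
    obtain ⟨u', hu', hnot, hmax, rfl⟩ := hs
    set K := Submodule.span ℝ (U : Set (Vec d)) with hK
    set K' := Submodule.span ℝ ((insert u' U : Finset (Vec d)) : Set (Vec d)) with hK'
    have hKK' : K ≤ K' := Submodule.span_mono (by simp)
    have hu'K' : u' ∈ K' := Submodule.subset_span (by simp)
    set n := U.card with hn
    have hcard : (insert u' U).card = n + 1 := Finset.card_insert_of_notMem hnot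
    -- Distances to the span only decrease as it grows, so the bounds by earlier `‖w i‖` persist.
    have hproj : ∀ v, ‖K'ᗮ.starProjection v‖ ≤ ‖Kᗮ.starProjection v‖ := by
      intro v
      have h1 := DFunLike.congr_fun (Submodule.starProjection_comp_starProjection_of_le
        (Submodule.orthogonal_le hKK')) v
      rw [ContinuousLinearMap.comp_apply] at h1
      rw [← h1]
      exact Submodule.norm_starProjection_apply_le _ _
    have hinner : ∀ v, inner ℝ (Kᗮ.starProjection u') v
        = (inner ℝ (Kᗮ.starProjection u') (Kᗮ.starProjection v) : ℝ) := by
      intro v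
      rw [← Submodule.inner_starProjection_left_eq_right,
        Submodule.starProjection_eq_self_iff.2 (Submodule.starProjection_apply_mem _ _)]
    have horth : ∀ y ∈ K, inner ℝ (Kᗮ.starProjection u') y = (0 : ℝ) := fun y hy =>
      Submodule.inner_left_of_mem_orthogonal hy (Submodule.starProjection_apply_mem _ _)
    refine ⟨Function.update u n u', Function.update w n (Kᗮ.starProjection u'), ?_, ?_⟩
    · intro g
      rw [Finset.sum_insert hnot, hcard, Finset.sum_range_succ, Function.update_self, hsum,
        add_comm]
      congr 1
      refine Finset.sum_congr rfl fun i hi => ?_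
      rw [Function.update_of_ne (Finset.mem_range.1 hi).ne]
    rw [hcard]
    intro i hi
    rcases Nat.lt_succ_iff_lt_or_eq.1 hi with hi | rfl
    · obtain ⟨h1, h2, h3, h4, h5⟩ := huw i hi
      rw [Function.update_of_ne hi.ne, Function.update_of_ne hi.ne]
      refine ⟨Finset.mem_insert_of_mem h1, hKK' h2, fun j hj => ?_, h4, fun v hv =>
        ⟨(h5 v hv).1, (hproj v).trans (h5 v hv).2⟩⟩
      rw [Function.update_of_ne (hj.trans hi).ne, Function.update_of_ne (hj.trans hi).ne]
      exact h3 j hj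
    · simp only [Function.update_self]
      refine ⟨Finset.mem_insert_self _ _, ?_, fun j hj => ?_, ?_, fun v hv => ⟨?_, ?_⟩⟩
      · rw [Submodule.starProjection_orthogonal_val]
        exact K'.sub_mem hu'K' (hKK' (Submodule.starProjection_apply_mem _ _))
      · rw [Function.update_of_ne hj.ne, Function.update_of_ne hj.ne]
        exact ⟨horth _ (huw j hj).2.1, horth _ (Submodule.subset_span (huw j hj).1)⟩
      · rw [hinner, real_inner_self_eq_norm_sq]
      · rw [hinner, sq]
        refine (abs_real_inner_le_norm _ _).trans ?_
        gcongr
        exact hmax v hv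
      · exact (hproj v).trans (hmax v hv)

/-- Maps of small corank do not shrink the selected vectors too much, compared with the
distances of the input vectors from their span. -/
lemma card_mul_norm_sq_le_sum {k : ℕ} (h : Relation.ReflTransGen (VolumeStep V) ∅ U)
    (hU : 0 < U.card) (hk : k * Real.log (4 * U.card) ≤ U.card * Real.log 2)
    (P : Vec d →ₗ[ℝ] Vec d) (hP : Module.finrank ℝ (LinearMap.range (LinearMap.id - P)) ≤ k)
    {v : Vec d} (hv : v ∈ V) :
    (U.card : ℝ) / 4 * ‖(Submodule.span ℝ (U : Set (Vec d)))ᗮ.starProjection v‖ ^ 2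
      ≤ ∑ u ∈ U, ‖P u‖ ^ 2 := by
  have hUV := subset_of_volumeReachable h
  obtain ⟨u, w, hsum, huw⟩ := exists_gramSchmidt_of_volumeReachable h
  rw [hsum]
  set r := ‖(Submodule.span ℝ (U : Set (Vec d)))ᗮ.starProjection v‖ with hr
  set m := U.card with hm
  rcases (norm_nonneg _ : 0 ≤ r).eq_or_lt with hr0 | hr0
  · rw [hr, ← hr0, zero_pow two_ne_zero, mul_zero]
    exact Finset.sum_nonneg fun i _ => sq_nonneg _
  have hrw : ∀ i < m, r ≤ ‖w i‖ := fun i hi => ((huw i hi).2.2.2.2 v hv).2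
  have hw0 : ∀ i < m, 0 < ‖w i‖ := fun i hi => hr0.trans_le (hrw i hi)
  let T : Mat m := Matrix.of fun i j => inner ℝ ((‖w i‖ ^ 2)⁻¹ • w i) (u j)
  have hTval : ∀ i j, T i j = (‖w i‖ ^ 2)⁻¹ * inner ℝ (w i) (u j) := fun i j => by
    simp [T, inner_smul_left]
  have hdet : T.det = 1 := by
    rw [Matrix.det_of_isUpperTriangular]
    · refine Finset.prod_eq_one fun i _ => ?_
      rw [hTval, (huw i i.2).2.2.2.1]
      exact inv_mul_cancel₀ (pow_pos (hw0 i i.2) 2).ne'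
    · intro i j hij
      rw [hTval, ((huw i i.2).2.2.1 j hij).2, mul_zero]
  have hT : ∀ i j, |T i j| ≤ 1 := by
    intro i j
    have hp := pow_pos (hw0 i i.2) 2
    rw [hTval, abs_mul, abs_inv, abs_of_pos hp, inv_mul_le_one₀ hp]
    exact ((huw i i.2).2.2.2.2 _ (hUV (huw j j.2).1)).1
  have hmain := quarter_le_frobenius_sq_sub hU hk hdet hT _ hP
    (fun i => (‖w i‖ ^ 2)⁻¹ • w i) (fun j => u j - P (u j)) fun j => ⟨u j, by simp⟩
  have hon : Orthonormal ℝ fun i : Fin m => ‖w i‖⁻¹ • w i := by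
    refine ⟨fun i => ?_, fun i j hij => ?_⟩
    · rw [norm_smul, norm_inv, norm_norm]
      exact inv_mul_cancel₀ (hw0 i i.2).ne'
    · have h0 : inner ℝ (w i) (w j) = (0 : ℝ) := by
        rcases lt_or_gt_of_ne hij with hlt | hlt
        · rw [real_inner_comm]; exact ((huw j j.2).2.2.1 i hlt).1
        · exact ((huw i i.2).2.2.1 j hlt).1
      simp [inner_smul_left, inner_smul_right, h0]
  -- The difference has entries `⟨w i, P (u j)⟩ / ‖w i‖²`. One factor `1/‖w i‖` is bounded by `1/r`,
  -- the other normalizes `w i` for Bessel's inequality.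
  have hbound : ∑ i : Fin m, ∑ j : Fin m,
      (T i j - inner ℝ ((‖w i‖ ^ 2)⁻¹ • w i) (u j - P (u j))) ^ 2
      ≤ ∑ j : Fin m, (r ^ 2)⁻¹ * ‖P (u j)‖ ^ 2 := by
    rw [Finset.sum_comm]
    refine Finset.sum_le_sum fun j _ => ?_
    have hbessel := hon.sum_inner_products_le (P (u j)) (s := Finset.univ)
    refine le_trans ?_ (mul_le_mul_of_nonneg_left hbessel (by positivity : 0 ≤ (r ^ 2)⁻¹))
    rw [Finset.mul_sum]
    refine Finset.sum_le_sum fun i _ => ?_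
    have h1 : T i j - inner ℝ ((‖w i‖ ^ 2)⁻¹ • w i) (u j - P (u j))
        = ‖w i‖⁻¹ * inner ℝ (‖w i‖⁻¹ • w i) (P (u j)) := by
      simp only [T, Matrix.of_apply, inner_sub_right, inner_smul_left, RCLike.conj_to_real]
      ring
    rw [h1, mul_pow, Real.norm_eq_abs, sq_abs, inv_pow]
    gcongr
    exact hrw i i.2
  have h2 := hmain.trans hbound
  rw [← Finset.mul_sum, le_inv_mul_iff₀ (pow_pos hr0 2)] at h2
  rw [Finset.sum_range]
  linarith

/-- If the input has fewer than `m` vectors then `U = V`, and the left side vanishes. -/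
lemma volumeOutput_norm_sq_le {k m : ℕ} (hm : 0 < m)
    (hk : k * Real.log (4 * m) ≤ m * Real.log 2) (h : VolumeOutput V m U)
    (P : Vec d →ₗ[ℝ] Vec d) (hP : Module.finrank ℝ (LinearMap.range (LinearMap.id - P)) ≤ k)
    {v : Vec d} (hv : v ∈ V) :
    ‖(Submodule.span ℝ (U : Set (Vec d)))ᗮ.starProjection v‖ ^ 2
      ≤ 4 / m * ∑ u ∈ U, ‖P u‖ ^ 2 := by
  have hm' : (0 : ℝ) < m := by exact_mod_cast hm
  rcases le_or_gt m V.card with hmV | hmV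
  · have hcard : U.card = m := h.2.trans (min_eq_left hmV)
    have h1 := card_mul_norm_sq_le_sum h.1 (hcard ▸ hm) (by rwa [hcard]) P hP hv
    rw [hcard] at h1
    calc _ = 4 / m * ((m : ℝ) / 4
          * ‖(Submodule.span ℝ (U : Set (Vec d)))ᗮ.starProjection v‖ ^ 2) := by
            field_simp
      _ ≤ _ := by gcongr
  · have hUV : U = V := Finset.eq_of_subset_of_card_le (subset_of_volumeReachable h.1)
      (by rw [h.2, min_eq_right hmV.le])
    rw [starProjection_orthogonal_span_eq_zero (hUV ▸ hv)]
    simp only [norm_zero, ne_eq, OfNat.ofNat_ne_zero, not_false_eq_true, zero_pow]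
    positivity

open scoped Classical in
lemma exists_weights_of_kSpannerOutput {k m : ℕ} {α : ℝ} (hα : 0 ≤ α) (hm : 0 < m)
    (hk : k * Real.log (4 * m) ≤ m * Real.log 2) {W : Finset (Vec d)} (hU : VolumeOutput V m U)
    (hW : DSpannerOutput V (Submodule.span ℝ (U : Set (Vec d))).starProjection α W)
    {v : Vec d} (hv : v ∈ V) :
    ∃ μ : Vec d → ℝ, (∀ u, 0 ≤ μ u) ∧ ∑ u ∈ U ∪ W, μ u ≤ 20 * α + 8 ∧
      ∀ P : Vec d →ₗ[ℝ] Vec d, (∀ z, ‖P z‖ ≤ ‖z‖) →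
        Module.finrank ℝ (LinearMap.range (LinearMap.id - P)) ≤ k →
        ‖P v‖ ^ 2 ≤ ∑ u ∈ U ∪ W, μ u * ‖P u‖ ^ 2 := by
  have hm' : (0 : ℝ) < m := by exact_mod_cast hm
  have hWV := subset_of_reachable hW.1
  obtain ⟨l, hl0, hlsum, hl⟩ := exists_weights_of_forall_not_isBad hα (hW.2 v hv)
  set K := Submodule.span ℝ (U : Set (Vec d)) with hK
  have hUc : (U.card : ℝ) ≤ m := by
    rw [hU.2]; exact_mod_cast min_le_left _ _
  have hsplit : ∀ g : Vec d → ℝ, ∑ u ∈ U ∪ W,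
      ((if u ∈ W then 4 * l u else 0) + if u ∈ U then 4 / m * (4 * α + 2) else 0) * g u
      = 4 * ∑ u ∈ W, l u * g u + (4 * α + 2) * (4 / m * ∑ u ∈ U, g u) := by
    intro g
    generalize 4 * α + 2 = b
    simp only [add_mul, Finset.sum_add_distrib, ite_mul, zero_mul, Finset.sum_ite_mem,
      Finset.union_inter_cancel_left, Finset.union_inter_cancel_right]
    rw [Finset.mul_sum, Finset.mul_sum, Finset.mul_sum]
    congr 1 <;> exact Finset.sum_congr rfl fun u _ => by ring
  -- The parallelogram bound is used twice: to pass from `v` to its projection, and from projected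
  -- back to original `u ∈ W`. This gives the factor `4` on `l` and an error `(4α + 2)R`, paid for
  -- by `U`. The total is at most `4α + 4(4α + 2) = 20α + 8`.
  refine ⟨fun u => (if u ∈ W then 4 * l u else 0) + if u ∈ U then 4 / m * (4 * α + 2) else 0,
    fun u => ?_, ?_, fun P hP1 hPk => ?_⟩
  · have := hl0 u
    positivity
  · have h1 := hsplit fun _ => 1
    simp only [mul_one, Finset.sum_const, nsmul_eq_mul] at h1
    rw [h1]
    have h2 : 4 / (m : ℝ) * U.card ≤ 4 := by
      rw [div_mul_eq_mul_div, div_le_iff₀ hm']; linarith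
    nlinarith
  · rw [hsplit]
    set R := 4 / (m : ℝ) * ∑ u ∈ U, ‖P u‖ ^ 2 with hR
    have hR0 : 0 ≤ R := by positivity
    have herr : ∀ u ∈ V, ‖P (Kᗮ.starProjection u)‖ ^ 2 ≤ R := fun u hu =>
      (pow_le_pow_left₀ (norm_nonneg _) (hP1 _) 2).trans
        (volumeOutput_norm_sq_le hm hk hU P hPk hu)
    have hadd : ∀ u, P u = P (K.starProjection u) + P (Kᗮ.starProjection u) := fun u => by
      rw [← map_add, Submodule.starProjection_add_starProjection_orthogonal]
    have hpar : ∀ y z : Vec d, ‖y + z‖ ^ 2 ≤ 2 * ‖y‖ ^ 2 + 2 * ‖z‖ ^ 2 := fun y z => by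
      have := parallelogram_law_with_norm ℝ y z
      nlinarith [mul_self_nonneg ‖y - z‖]
    have h1 : ‖P v‖ ^ 2 ≤ 2 * ‖P (K.starProjection v)‖ ^ 2 + 2 * R := by
      rw [hadd v]
      linarith [hpar (P (K.starProjection v)) (P (Kᗮ.starProjection v)), herr v hv]
    have h2 : ∑ u ∈ W, l u * ‖P (K.starProjection u)‖ ^ 2
        ≤ ∑ u ∈ W, (2 * (l u * ‖P u‖ ^ 2) + 2 * R * l u) := by
      refine Finset.sum_le_sum fun u hu => ?_
      have h3 : P (K.starProjection u) = P u + -P (Kᗮ.starProjection u) := by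
        rw [hadd u]; abel
      have h4 := hpar (P u) (-P (Kᗮ.starProjection u))
      rw [← h3, norm_neg] at h4
      have h5 := mul_le_mul_of_nonneg_left (h4.trans (by linarith [herr u (hWV hu)] :
        _ ≤ 2 * ‖P u‖ ^ 2 + 2 * R)) (hl0 u)
      linarith
    rw [Finset.sum_add_distrib, ← Finset.mul_sum, ← Finset.mul_sum] at h2
    have h6 := hl P
    have h7 : 2 * R * ∑ u ∈ W, l u ≤ 2 * R * α := by gcongr
    linarith

end Volume

/-! ### Projection matrices and the order `≼ₖ` -/

lemma IsProjectionOfRank.inner_toEuclideanLin {d r : ℕ} {P : Mat d}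
    (hP : IsProjectionOfRank r P) (v : Vec d) :
    inner ℝ v (Matrix.toEuclideanLin P v) = ‖Matrix.toEuclideanLin P v‖ ^ 2 := by
  rw [← real_inner_self_eq_norm_sq, EuclideanSpace.inner_eq_star_dotProduct,
    EuclideanSpace.inner_eq_star_dotProduct]
  simp only [Matrix.ofLp_toLpLin, Matrix.toLin'_apply, star_trivial]
  conv_rhs => rw [Matrix.dotProduct_mulVec, Matrix.vecMul_mulVec, hP.1, hP.2.1]
  rw [← Matrix.dotProduct_mulVec, dotProduct_comm]

lemma IsProjectionOfRank.norm_toEuclideanLin_le {d r : ℕ} {P : Mat d}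
    (hP : IsProjectionOfRank r P) (v : Vec d) : ‖Matrix.toEuclideanLin P v‖ ≤ ‖v‖ := by
  have h1 := hP.inner_toEuclideanLin v
  have h2 := real_inner_le_norm v (Matrix.toEuclideanLin P v)
  rw [h1, sq] at h2
  rcases (norm_nonneg (Matrix.toEuclideanLin P v)).eq_or_lt with h | h
  · rw [← h]; exact norm_nonneg _
  · exact le_of_mul_le_mul_right h2 h

lemma IsProjectionOfRank.trace_outer_mul {d r : ℕ} {P : Mat d}
    (hP : IsProjectionOfRank r P) (v : Vec d) :
    (outer v * P.transpose).trace = ‖Matrix.toEuclideanLin P v‖ ^ 2 := by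
  rw [← hP.inner_toEuclideanLin, outer, Matrix.vecMulVec_mul, Matrix.trace_vecMulVec,
    Matrix.vecMul_transpose, EuclideanSpace.inner_eq_star_dotProduct, dotProduct_comm]
  simp

lemma IsProjectionOfRank.finrank_range_id_sub_le {d k : ℕ} (hkd : k ≤ d) {P : Mat d}
    (hP : IsProjectionOfRank (d - k + 1) P) :
    Module.finrank ℝ (LinearMap.range (LinearMap.id - Matrix.toEuclideanLin P)) ≤ k := by
  have h1 : LinearMap.range (LinearMap.id - Matrix.toEuclideanLin P)
      ≤ LinearMap.ker (Matrix.toEuclideanLin P) := by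
    rintro _ ⟨v, rfl⟩
    ext i
    simp [Matrix.mulVec_mulVec, hP.2.1]
  have h2 := Submodule.finrank_mono h1
  have h3 := LinearMap.finrank_range_add_finrank_ker (Matrix.toEuclideanLin P)
  have h4 : Module.finrank ℝ (LinearMap.range (Matrix.toEuclideanLin P)) = d - k + 1 := by
    have h5 : Matrix.toEuclideanLin P = Matrix.toLin (PiLp.basisFun 2 ℝ (Fin d))
        (PiLp.basisFun 2 ℝ (Fin d)) P := DFunLike.congr_fun (Matrix.toLpLin_eq_toLin 2 2) P
    rw [← hP.2.2, h5, ← Matrix.rank_eq_finrank_range_toLin]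
  rw [finrank_euclideanSpace_fin] at h3
  omega

lemma kLe_sum_outer_of_norm_sq_le {d k : ℕ} (hkd : k ≤ d) {S : Finset (Vec d)} {v : Vec d}
    {μ : Vec d → ℝ}
    (h : ∀ P : Vec d →ₗ[ℝ] Vec d, (∀ z, ‖P z‖ ≤ ‖z‖) →
      Module.finrank ℝ (LinearMap.range (LinearMap.id - P)) ≤ k →
      ‖P v‖ ^ 2 ≤ ∑ u ∈ S, μ u * ‖P u‖ ^ 2) :
    KLe k (outer v) (∑ u ∈ S, μ u • outer u) := by
  intro P hP
  rw [hP.trace_outer_mul, Finset.sum_mul, Matrix.trace_sum]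
  refine (h _ hP.norm_toEuclideanLin_le (hP.finrank_range_id_sub_le hkd)).trans_eq ?_
  refine Finset.sum_congr rfl fun u _ => ?_
  rw [Matrix.smul_mul, Matrix.trace_smul, hP.trace_outer_mul, smul_eq_mul]

/-! ### From domination to composable core-sets -/

lemma posSemidef_outer {d : ℕ} (v : Vec d) : (outer v).PosSemidef := by
  simpa [outer] using Matrix.posSemidef_vecMulVec_self_star v.ofLp

lemma posSemidef_sum_smul_outer {d : ℕ} {S : Finset (Vec d)} {s : Vec d → ℝ}
    (hs : ∀ u ∈ S, 0 ≤ s u) : (∑ u ∈ S, s u • outer u).PosSemidef :=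
  Matrix.posSemidef_sum _ fun u hu => (posSemidef_outer u).smul (hs u hu)

lemma outer_smul {d : ℕ} (c : ℝ) (v : Vec d) : outer (c • v) = (c ^ 2) • outer v := by
  ext i j
  simp only [outer, Matrix.vecMulVec_apply, PiLp.smul_apply, smul_eq_mul, Matrix.smul_apply]
  ring

lemma KLe.smul {d k : ℕ} {A B : Mat d} (h : KLe k A B) {c : ℝ} (hc : 0 ≤ c) :
    KLe k (c • A) (c • B) := by
  intro P hP
  rw [Matrix.smul_mul, Matrix.smul_mul, Matrix.trace_smul, Matrix.trace_smul]
  exact mul_le_mul_of_nonneg_left (h P hP) hc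

/-- The vectors are exchanged one at a time, with `A` absorbing those already exchanged. A
coefficient `s v` goes into the vector as `√(s v)`. -/
lemma IsVectorMonotone.add_sum_le {d k : ℕ} {f : Mat d → ℝ≥0} (hf : IsVectorMonotone k f)
    {X : Finset (Vec d)} {M : Vec d → Mat d} {s : Vec d → ℝ} (hs : ∀ v ∈ X, 0 ≤ s v)
    (hM : ∀ v ∈ X, (M v).PosSemidef) (hk : ∀ v ∈ X, KLe k (outer v) (M v)) :
    ∀ A : Mat d, A.PosSemidef →
      f (A + ∑ v ∈ X, s v • M v) ≤ f (A + ∑ v ∈ X, s v • outer v) := by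
  classical
  induction X using Finset.induction_on with
  | empty => intro A _; simp
  | insert v X hv ih =>
    intro A hA
    have hX := fun w (hw : w ∈ X) => Finset.mem_insert_of_mem (a := w) (b := v) hw
    have ih' := ih (fun w hw => hs w (hX w hw)) (fun w hw => hM w (hX w hw))
      (fun w hw => hk w (hX w hw))
    have hsv := hs v (Finset.mem_insert_self _ _)
    have hMv := (hM v (Finset.mem_insert_self _ _)).smul hsv
    rw [Finset.sum_insert hv, Finset.sum_insert hv, ← add_assoc, ← add_assoc]
    refine (ih' _ (hA.add hMv)).trans ?_
    have h1 : outer (Real.sqrt (s v) • v) = s v • outer v := by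
      rw [outer_smul, Real.sq_sqrt hsv]
    have h2 := hf (A + ∑ w ∈ X, s w • outer w) (s v • M v) (Real.sqrt (s v) • v)
      (hA.add (posSemidef_sum_smul_outer fun w hw => hs w (hX w hw))) hMv
      (by rw [h1]; exact (hk v (Finset.mem_insert_self _ _)).smul hsv)
    rw [h1] at h2
    rwa [add_right_comm A (s v • M v), add_right_comm A (s v • outer v)]

lemma le_beta_mul {d : ℕ} {f : Mat d → ℝ≥0} {t : ℝ} (hβ : beta f t ≠ ⊤) {A : Mat d}
    (hA : A.PosSemidef) : (f A : ℝ≥0∞) ≤ beta f t * f (t • A) := by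
  have h : (f A : ℝ≥0∞) / (f (t • A) : ℝ≥0∞) ≤ beta f t :=
    le_iSup₂ (f := fun (A : Mat d) (_ : A.PosSemidef) => (f A : ℝ≥0∞) / (f (t • A) : ℝ≥0∞)) A hA
  refine (ENNReal.div_le_iff_le_mul (Or.inr hβ) (Or.inl ENNReal.coe_ne_top)).1 h

/-- If every vector of `X` is spectrally dominated by a combination of vectors of `S`, then `S`
is nearly as good as `X` for the fractional budgeted minimization problem. -/
lemma fracOpt_le_beta_mul {d k : ℕ} {f : Mat d → ℝ≥0} (hf : IsVectorMonotone k f) {τ : ℝ}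
    (hτ : 0 < τ) (hβ : beta f τ ≠ ⊤) {X S : Finset (Vec d)}
    (h : ∀ v ∈ X, ∃ μ : Vec d → ℝ, (∀ u, 0 ≤ μ u) ∧ ∑ u ∈ S, μ u ≤ τ ∧
      KLe k (outer v) (∑ u ∈ S, μ u • outer u)) {B : ℝ} (hB : 0 < B) :
    fracOpt f S B ≤ beta f τ * fracOpt f X B := by
  classical
  have hval : ∀ s, IsFeasible X B s →
      fracOpt f S B ≤ beta f τ * f (∑ v ∈ X, s v • outer v) := by
    intro s hs
    choose! μ hμ0 hμ1 hμk using h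
    -- Each `v` passes its budget to its dominating combination; division by `τ` keeps the total
    -- within `B`.
    let s' : Vec d → ℝ := fun u => ∑ v ∈ X, s v * (μ v u / τ)
    have hs' : IsFeasible S B s' := by
      refine ⟨fun u _ => Finset.sum_nonneg fun v hv =>
        mul_nonneg (hs.1 v hv) (div_nonneg (hμ0 v hv u) hτ.le), ?_⟩
      rw [Finset.sum_comm]
      refine le_trans (Finset.sum_le_sum fun v hv => ?_) hs.2
      rw [← Finset.mul_sum, ← Finset.sum_div]
      exact mul_le_of_le_one_right (hs.1 v hv) ((div_le_one hτ).2 (hμ1 v hv))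
    have hpsd : (∑ u ∈ S, s' u • outer u).PosSemidef := posSemidef_sum_smul_outer hs'.1
    have heq : τ • ∑ u ∈ S, s' u • outer u
        = ∑ v ∈ X, s v • ∑ u ∈ S, μ v u • outer u := by
      simp only [s', Finset.smul_sum, Finset.sum_smul, smul_smul]
      rw [Finset.sum_comm]
      refine Finset.sum_congr rfl fun v _ => Finset.sum_congr rfl fun u _ => ?_
      congr 1
      field_simp
    have hmono := hf.add_sum_le (M := fun v => ∑ u ∈ S, μ v u • outer u) hs.1
      (fun v hv => posSemidef_sum_smul_outer fun u _ => hμ0 v hv u) hμk 0 Matrix.PosSemidef.zero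
    rw [zero_add, zero_add, ← heq] at hmono
    calc fracOpt f S B ≤ f (∑ u ∈ S, s' u • outer u) := iInf₂_le s' hs'
      _ ≤ beta f τ * f (τ • ∑ u ∈ S, s' u • outer u) := le_beta_mul hβ hpsd
      _ ≤ _ := by gcongr
  -- The infimum need not be attained, so the bound is proved for each feasible `s` and the factor
  -- moved inside.
  have h0 : IsFeasible X B fun _ => 0 := ⟨fun _ _ => le_rfl, by simpa using hB.le⟩
  have : Nonempty {s // IsFeasible X B s} := ⟨⟨_, h0⟩⟩
  have hX : fracOpt f X B
      = ⨅ s : {s // IsFeasible X B s}, (f (∑ v ∈ X, s.1 v • outer v) : ℝ≥0∞) := iInf_subtype'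
  rw [hX, ENNReal.mul_iInf fun htop => absurd htop hβ]
  exact le_iInf fun s => hval s.1 s.2

lemma isComposableCoreset_of_dominated {d k : ℕ} {f : Mat d → ℝ≥0} (hf : IsVectorMonotone k f)
    {τ t : ℝ} (hτ : 0 < τ) {c : Finset (Vec d) → Finset (Vec d)} (hsub : ∀ V, c V ⊆ V)
    (hcard : ∀ V, ((c V).card : ℝ) ≤ t)
    (h : ∀ V, ∀ v ∈ V, ∃ μ : Vec d → ℝ, (∀ u, 0 ≤ μ u) ∧ ∑ u ∈ c V, μ u ≤ τ ∧
      KLe k (outer v) (∑ u ∈ c V, μ u • outer u)) :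
    IsComposableCoreset f (beta f τ) t c := by
  classical
  refine ⟨hsub, hcard, fun hβ B hB p V => ?_⟩
  have := fracOpt_le_beta_mul hf hτ hβ (X := Finset.univ.biUnion V)
    (S := Finset.univ.biUnion fun i => c (V i)) (fun v hv => ?_) hB
  · convert this
  obtain ⟨i, -, hi⟩ := Finset.mem_biUnion.1 hv
  obtain ⟨μ, hμ0, hμ1, hμk⟩ := h (V i) v hi
  have hci : c (V i) ⊆ Finset.univ.biUnion fun i => c (V i) :=
    Finset.subset_biUnion_of_mem (fun i => c (V i)) (Finset.mem_univ i)
  refine ⟨fun u => if u ∈ c (V i) then μ u else 0, fun u => ?_, ?_, ?_⟩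
  · have := hμ0 u
    positivity
  · rwa [Finset.sum_ite_mem, Finset.inter_eq_right.2 hci]
  · simpa only [ite_smul, zero_smul, Finset.sum_ite_mem, Finset.inter_eq_right.2 hci] using hμk

/-- The span of `U` has dimension at most `min m d`. The bound `d` is what saves a logarithm when `k
= d`, since `n` can then be taken equal to `m`. -/
lemma kSpanner_givesCoreset {d k m n : ℕ} {α τ t : ℝ} (hkd : k ≤ d) (hα : 1 ≤ α) (hm : 0 < m)
    (hk : k * Real.log (4 * m) ≤ m * Real.log 2) (hn : 0 < n)
    (hD : (min m d : ℕ) * Real.log (4 * n) ≤ n * Real.log 2) (hnα : 4 * n < α)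
    (hτ : 20 * α + 8 ≤ τ) (ht : (m : ℝ) + n ≤ t) :
    GivesCoreset (fun V S : Finset (Vec d) => KSpannerOutput V m α S) k τ t := by
  classical
  refine ⟨fun V => ?_, fun c hc f hf => ?_⟩
  · obtain ⟨U, hU⟩ := exists_volumeOutput V m
    obtain ⟨W, hW⟩ := exists_dSpannerOutput (V := V)
      (φ := (Submodule.span ℝ (U : Set (Vec d))).starProjection) hα
    exact ⟨_, U, W, hU, hW, rfl⟩
  · choose U W hU hW hUW using hc
    have hUW' : ∀ V, c V = U V ∪ W V := fun V => by rw [hUW]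
    refine isComposableCoreset_of_dominated hf (by linarith) (fun V => ?_) (fun V => ?_)
      fun V v hv => ?_
    · rw [hUW' V]
      exact Finset.union_subset (subset_of_volumeReachable (hU V).1)
        (subset_of_reachable (hW V).1)
    · have h1 : (U V).card ≤ m := (hU V).2.trans_le (min_le_left _ _)
      have h2 : (W V).card ≤ n := by
        refine card_le_of_reachable hn hD hnα _ ?_
          (Submodule.starProjection_apply_mem _) (hW V).1
        refine le_min ((finrank_span_finset_le_card _).trans h1) ?_
        simpa using Submodule.finrank_le (Submodule.span ℝ (U V : Set (Vec d)))
      have h3 : (c V).card ≤ m + n := by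
        rw [hUW' V]
        exact (Finset.card_union_le _ _).trans (add_le_add h1 h2)
      refine le_trans ?_ ht
      exact_mod_cast h3
    · obtain ⟨μ, hμ0, hμ1, hμ⟩ := exists_weights_of_kSpannerOutput (by linarith) hm hk (hU V)
        (hW V) hv
      have h := kLe_sum_outer_of_norm_sq_le hkd hμ
      rw [hUW' V]
      exact ⟨μ, hμ0, hμ1.trans hτ, h⟩

lemma dSpanner_givesCoreset {d k n : ℕ} {α τ t : ℝ} (hkd : k ≤ d) (hα : 1 ≤ α) (hn : 0 < n)
    (hD : d * Real.log (4 * n) ≤ n * Real.log 2) (hnα : 4 * n < α) (hτ : α ≤ τ)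
    (ht : (n : ℝ) ≤ t) :
    GivesCoreset (fun V S : Finset (Vec d) => DSpannerOutput V id α S) k τ t := by
  refine ⟨fun V => exists_dSpannerOutput hα, fun c hc f hf => ?_⟩
  refine isComposableCoreset_of_dominated hf (by linarith)
    (fun V => subset_of_reachable (hc V).1) (fun V => ?_) fun V v hv => ?_
  · refine le_trans ?_ ht
    exact_mod_cast card_le_of_reachable hn hD hnα ⊤ (by simp) (fun _ => trivial) (hc V).1
  · obtain ⟨μ, hμ0, hμ1, hμ⟩ :=
      exists_weights_of_forall_not_isBad (by linarith) ((hc V).2 v hv)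
    exact ⟨μ, hμ0, hμ1.trans hτ, kLe_sum_outer_of_norm_sq_le hkd fun P _ _ => hμ P⟩

/-! ### Choice of the parameters -/

lemma log_two_le_log_succ {k : ℕ} (hk : 1 ≤ k) : Real.log 2 ≤ Real.log (k + 1) := by
  have : (1 : ℝ) ≤ k := by exact_mod_cast hk
  exact Real.log_le_log (by norm_num) (by linarith)

lemma ceil_mul_log_bounds {k m : ℕ} (hk : 1 ≤ k) (hm : m = ⌈14 * k * Real.log (k + 1)⌉₊) :
    0 < m ∧ k * Real.log (4 * m) ≤ m * Real.log 2 ∧ (m : ℝ) ≤ 16 * k * Real.log (k + 1) := by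
  have hk1 : (1 : ℝ) ≤ k := by exact_mod_cast hk
  have hl2 := Real.log_two_gt_d9
  have hL := log_two_le_log_succ hk
  have hLk : Real.log (k + 1) ≤ k := by
    have := Real.log_le_sub_one_of_pos (show (0 : ℝ) < k + 1 by linarith)
    linarith
  set L := Real.log (k + 1) with hLdef
  have hkL : L ≤ k * L := by nlinarith
  have hm1 : 14 * k * L ≤ m := hm ▸ Nat.le_ceil _
  have hm2 : (m : ℝ) < 14 * k * L + 1 := hm ▸ Nat.ceil_lt_add_one (by nlinarith)
  have hmpos : (0 : ℝ) < m := by nlinarith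
  have hm3 : (m : ℝ) ≤ 16 * k * L := by nlinarith
  refine ⟨by exact_mod_cast hmpos, ?_, hm3⟩
  -- Since `log 2 ≤ L`, this is at most `8L`, and `14 log 2 > 8` explains the constant `14`.
  have hlog : Real.log (4 * m) ≤ 6 * Real.log 2 + 2 * L := by
    have h1 : (4 * m : ℝ) ≤ 2 ^ 6 * (k + 1) ^ 2 := by nlinarith
    calc Real.log (4 * m) ≤ Real.log (2 ^ 6 * (k + 1) ^ 2) := Real.log_le_log (by linarith) h1
      _ = 6 * Real.log 2 + 2 * L := by
        rw [Real.log_mul (by positivity) (by positivity), Real.log_pow, Real.log_pow]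
        norm_num
        rfl
  calc k * Real.log (4 * m) ≤ k * (8 * L) := by gcongr; linarith
    _ ≤ 14 * k * L * Real.log 2 := by nlinarith
    _ ≤ m * Real.log 2 := by gcongr

lemma ceil_mul_log_ceil_le {k m n : ℕ} (hk : 1 ≤ k)
    (hm : m = ⌈14 * k * Real.log (k + 1)⌉₊) (hn : n = ⌈14 * m * Real.log (m + 1)⌉₊) :
    (n : ℝ) ≤ 1536 * k * Real.log (k + 1) ^ 2 := by
  have hk1 : (1 : ℝ) ≤ k := by exact_mod_cast hk
  have hl2 := Real.log_two_gt_d9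
  have hL := log_two_le_log_succ hk
  have hLk : Real.log (k + 1) ≤ k := by
    have := Real.log_le_sub_one_of_pos (show (0 : ℝ) < k + 1 by linarith)
    linarith
  obtain ⟨hm0, -, hm1⟩ := ceil_mul_log_bounds hk hm
  obtain ⟨-, -, hn1⟩ := ceil_mul_log_bounds hm0 hn
  set L := Real.log (k + 1) with hLdef
  have hlog : Real.log (m + 1) ≤ 6 * L := by
    have h1 : (m + 1 : ℝ) ≤ 2 ^ 4 * (k + 1) ^ 2 := by nlinarith
    calc Real.log (m + 1) ≤ Real.log (2 ^ 4 * (k + 1) ^ 2) := Real.log_le_log (by positivity) h1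
      _ = 4 * Real.log 2 + 2 * L := by
        rw [Real.log_mul (by positivity) (by positivity), Real.log_pow, Real.log_pow]
        norm_num
        rfl
      _ ≤ 6 * L := by linarith
  have hL0 : 0 ≤ L := by linarith
  have hlog0 : 0 ≤ Real.log (m + 1) :=
    Real.log_nonneg (by linarith [Nat.cast_nonneg (α := ℝ) m])
  calc (n : ℝ) ≤ 16 * m * Real.log (m + 1) := hn1
    _ ≤ 16 * (16 * k * L) * (6 * L) := by gcongr
    _ = 1536 * k * L ^ 2 := by ring

end SpectralSpanner

open SpectralSpanner

theorem mainTheorem9 :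
    -- `a`, `b` are the constants in the parameters of the algorithms, `C` that in the bounds
    ∃ a b C : ℝ, 0 < a ∧ 0 < b ∧ 0 < C ∧
      -- the bound for general `k`
      (∀ d k : ℕ, 1 ≤ k → k ≤ d →
        ∀ (m : ℕ) (α : ℝ), m = ⌈a * k * Real.log (k + 1)⌉₊ → α = b * k * Real.log (k + 1) ^ 3 →
          (∀ V : Finset (SpectralSpanner.Vec d), SpectralSpanner.KSpannerHalts V m α) ∧
          SpectralSpanner.GivesCoreset
            (fun V S : Finset (SpectralSpanner.Vec d) => SpectralSpanner.KSpannerOutput V m α S)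
            k (C * k * Real.log (k + 1) ^ 3) (C * k * Real.log (k + 1) ^ 2)) ∧
      -- the improved bound for `k = d`, for the `k`-spanner and the `d`-spanner algorithm
      (∀ d : ℕ, 1 ≤ d →
        ∀ (m : ℕ) (α : ℝ), m = ⌈a * d * Real.log (d + 1)⌉₊ → α = b * d * Real.log (d + 1) ^ 2 →
          (∀ V : Finset (SpectralSpanner.Vec d), SpectralSpanner.KSpannerHalts V m α) ∧
          SpectralSpanner.GivesCoreset
            (fun V S : Finset (SpectralSpanner.Vec d) => SpectralSpanner.KSpannerOutput V m α S)
            d (C * d * Real.log (d + 1) ^ 2) (C * d * Real.log (d + 1)) ∧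
          (∀ V : Finset (SpectralSpanner.Vec d), SpectralSpanner.DSpannerHalts V id α) ∧
          SpectralSpanner.GivesCoreset
            (fun V S : Finset (SpectralSpanner.Vec d) => SpectralSpanner.DSpannerOutput V id α S)
            d (C * d * Real.log (d + 1) ^ 2) (C * d * Real.log (d + 1))) := by
  have hl2 := Real.log_two_gt_d9
  -- The constant `10000` ensures `4n < α`, as `4n ≤ 6144 k L²` and `L > 0.69`; `1000000` absorbs
  -- `20α + 8` and the sizes.
  refine ⟨14, 10000, 1000000, by norm_num, by norm_num, by norm_num, ?_, ?_⟩
  · intro d k hk hkd m α hm hα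
    have hk1 : (1 : ℝ) ≤ k := by exact_mod_cast hk
    have hL := log_two_le_log_succ hk
    obtain ⟨hm0, hmk, hm1⟩ := ceil_mul_log_bounds hk hm
    obtain ⟨hn0, hnm, -⟩ := ceil_mul_log_bounds hm0 rfl
    have hn1 := ceil_mul_log_ceil_le hk hm rfl
    set n := ⌈14 * m * Real.log (m + 1)⌉₊
    set L := Real.log (k + 1) with hLdef
    have hL0 : 0.69 ≤ L := by linarith
    have hL1 : 0.69 * (k * L) ≤ k * L ^ 2 := by
      have : 0 ≤ (k * L) * (L - 0.69) := mul_nonneg (by positivity) (by linarith)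
      linarith
    have hL2 : 0.69 * (k * L ^ 2) ≤ k * L ^ 3 := by
      have : 0 ≤ (k * L ^ 2) * (L - 0.69) := mul_nonneg (by positivity) (by linarith)
      linarith
    have hkL : 0.69 ≤ k * L := by nlinarith
    have hα1 : 1 ≤ α := by linarith
    refine ⟨fun V U _ => dSpannerHalts hα1, kSpanner_givesCoreset hkd hα1 hm0 hmk hn0 ?_ ?_ ?_ ?_⟩
    · refine le_trans ?_ hnm
      have hn4 : 0 ≤ Real.log (4 * n) := Real.log_nonneg (by
        have : (1 : ℝ) ≤ n := by exact_mod_cast hn0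
        linarith)
      gcongr
      exact min_le_left _ _
    · linarith
    · linarith
    · linarith
  · intro d hd m α hm hα
    have hd1 : (1 : ℝ) ≤ d := by exact_mod_cast hd
    have hL := log_two_le_log_succ hd
    obtain ⟨hm0, hmd, hm1⟩ := ceil_mul_log_bounds hd hm
    set L := Real.log (d + 1) with hLdef
    have hL0 : 0.69 ≤ L := by linarith
    have hdL : 0.69 ≤ d * L := by nlinarith
    have hL1 : 0.69 * (d * L) ≤ d * L ^ 2 := by
      have : 0 ≤ (d * L) * (L - 0.69) := mul_nonneg (by linarith) (by linarith)
      linarith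
    have hα1 : 1 ≤ α := by linarith
    refine ⟨fun V U _ => dSpannerHalts hα1,
      kSpanner_givesCoreset le_rfl hα1 hm0 hmd hm0 ?_ ?_ ?_ ?_,
      fun V => dSpannerHalts hα1, dSpanner_givesCoreset le_rfl hα1 hm0 hmd ?_ ?_ ?_⟩
    · refine le_trans ?_ hmd
      have hm4 : 0 ≤ Real.log (4 * m) := Real.log_nonneg (by
        have : (1 : ℝ) ≤ m := by exact_mod_cast hm0
        linarith)
      gcongr
      exact min_le_right _ _
    all_goals linarith
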